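/- Let $q$ be a prime power, let $m \ge 1$ and $s \ge 0$ be integers, and let $1 \le \ell_1 < \ell_2 < \cdots < \ell_s < \frac m2$ be integers. Let $\mathcal{L} = \langle x^{q^{\ell_1}}, \ldots, x^{q^{\ell_s}} \rangle$ be the $\mathbb{F}_{q^m}$-subspace of $\mathbb{F}_{q^m}[x]$ spanned by these monomials, and for $R \in \mathcal{L}$ let $Q_R(x) = \mathrm{Tr}_{q^m/q}(xR(x))$, a quadratic form on the $\mathbb{F}_q$-vector space $\mathbb{F}_{q^m}$. The rank of a quadratic form $Q$ on $\mathbb{F}_{q^m}$ is the codimension of $\{y : Q(y)=0,\ Q(x+y)=Q(x) \text{ for all } x\}$. A quadratic form of even rank $r$ is of type $+1$ if in suitable linear coordinates it is $u_1v_1+\cdots+u_{r/2}v_{r/2}$, and of type $-1$ if in suitable linear coordinates it is $u_1v_1+\cdots+u_{r/2-1}v_{r/2-1}+N(y,z)$ with $N$ an anisotropic binary quadratic form. Assume that $\mathcal{L}$ is an even rank family, i.e. $Q_R$ has even rank for every $R \in \mathcal{L}$. Let $R_{\mathcal{L}}$ be the set of ranks of the forms $Q_R$, $R \in \mathcal{L}$,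 and let $M_{r,1}$ (resp. $M_{r,2}$) be the number of $R \in \mathcal{L}\smallsetminus\{0\}$ for which $Q_R$ has rank $r$ and type $+1$ (resp. type $-1$). Consider the codes of length $q^m-1$ over $\mathbb{F}_q$ $$\mathcal{C}_{\mathcal{L}} = \big\{ (\mathrm{Tr}_{q^m/q}(xR(x)))_{x \in \mathbb{F}_{q^m}^*} : R \in \mathcal{L} \big\}, \qquad \mathcal{C}_{\mathcal{L},0} = \big\{ (\mathrm{Tr}_{q^m/q}(xR(x)) + b)_{x \in \mathbb{F}_{q^m}^*} : R \in \mathcal{L},\ b \in \mathbb{F}_q \big\}.$$ Then $\mathcal{C}_{\mathcal{L}}$ and $\mathcal{C}_{\mathcal{L},0}$ are cyclic (with the coordinates ordered as $1, \alpha, \alpha^2, \ldots, \alpha^{q^m-2}$ for any generator $\alpha$ of $\mathbb{F}_{q^m}^*$), their dimensions over $\mathbb{F}_q$ are $ms$ and $ms+1$ respectively, and their weight distributions are as follows, where $r$ runs over $R_{\mathcal{L}}$, $i$ over $\{1,2\}$, and the frequencies of rows with equal weights are added. For $\mathcal{C}_{\mathcal{L}}$: - weight $0$ with frequency $1$; -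 weight $q^m - q^{m-1} + (-1)^i (q-1) q^{m-\frac r2-1}$ with frequency $M_{r,i}$. For $\mathcal{C}_{\mathcal{L},0}$: - weight $0$ with frequency $1$; - weight $q^m-1$ with frequency $q-1$; - weight $q^m - q^{m-1} + (-1)^i (q-1) q^{m-\frac r2-1}$ with frequency $M_{r,i}$; - weight $q^m - q^{m-1} + (-1)^{i+1} q^{m-\frac r2-1} - 1$ with frequency $M_{r,i}(q-1)$. No other weights occur. -/

import Mathlib

open Polynomial Module

noncomputable section

namespace TraceCode

section QuadraticForms

variable {F V : Type*} [Field F] [AddCommGroup V] [Module F V]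

/-- The function `Q : V → F` is a quadratic form of rank `r`. The rank is the codimension of the
subspace `{y | Q y = 0 ∧ ∀ x, Q (y + x) = Q x}`, which is Mathlib's `QuadraticMap.radical`
(see `QuadraticMap.mem_radical_iff'`; no assumption on the characteristic). -/
def HasRank (Q : V → F) (r : ℕ) : Prop :=
  ∃ B : QuadraticForm F V, (∀ x, B x = Q x) ∧ finrank F (V ⧸ B.radical) = r

/-- Type `1` (sign `+1`): in suitable linear coordinates on `V`,
`Q = u₁v₁ + ⋯ + uₖvₖ`; the remaining `d` coordinates do not occur. -/
def IsHyperbolicType (Q : V → F) : Prop :=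
  ∃ (k d : ℕ) (e : V ≃ₗ[F] (Fin k → F × F) × (Fin d → F)),
    ∀ x, Q x = ∑ i, ((e x).1 i).1 * ((e x).1 i).2

/-- Type `3` (sign `-1`): in suitable linear coordinates on `V`,
`Q = u₁v₁ + ⋯ + uₖvₖ + N(y, z)` with `N` an anisotropic binary quadratic form;
the remaining `d` coordinates do not occur. -/
def IsEllipticType (Q : V → F) : Prop :=
  ∃ (k d : ℕ) (N : QuadraticForm F (F × F))
    (e : V ≃ₗ[F] (Fin k → F × F) × (F × F) × (Fin d → F)),
    N.Anisotropic ∧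
      ∀ x, Q x = ∑ i, ((e x).1 i).1 * ((e x).1 i).2 + N (e x).2.1

end QuadraticForms

section Codes

variable {F : Type*} [Field F]

/-- A code `C ⊆ F^n` is cyclic: it is closed under
`(c₁, …, cₙ) ↦ (cₙ, c₁, …, cₙ₋₁)`. -/
def IsCyclicCode {n : ℕ} (C : Submodule F (Fin n → F)) : Prop :=
  ∀ c ∈ C, (fun i => c ((finRotate n).symm i)) ∈ C

/-- The frequency `A_w`: the number of codewords of Hamming weight `w`. -/
def frequency {ι : Type*} [Fintype ι] [DecidableEq F] (C : Submodule F (ι → F)) (w : ℕ) : ℕ :=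
  Set.ncard {c : ι → F | c ∈ C ∧ hammingNorm c = w}

end Codes

/-- The `K`-subspace `⟨x^{q^{ℓ₁}}, …, x^{q^{ℓₛ}}⟩` of `K[x]`. -/
def linearizedFamily (K : Type*) [Field K] (q : ℕ) {s : ℕ} (ℓ : Fin s → ℕ) : Submodule K K[X] :=
  Submodule.span K (Set.range fun j => (X : K[X]) ^ q ^ ℓ j)

section TraceForms

variable (F : Type*) {K : Type*} [Field F] [Field K] [Algebra F K]

/-- `Q_R(x) = Tr_{K/F}(x R(x))`. -/
def traceForm (R : K[X]) (x : K) : F := Algebra.trace F K (x * R.eval x)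

/-- `Q_R` has even rank for every `R` in the family. -/
def IsEvenRankFamily (L : Submodule K K[X]) : Prop :=
  ∀ R ∈ L, ∃ r, Even r ∧ HasRank (traceForm F R) r

/-- `K_{r,i}`: the nonzero `R ∈ L` for which `Q_R` has rank `r` and type `1` (for `i = 1`)
or type `3` (for `i = 2`). -/
def rankTypeSet (L : Submodule K K[X]) (r i : ℕ) : Set K[X] :=
  {R | R ∈ L ∧ R ≠ 0 ∧ HasRank (traceForm F R) r ∧
    ((i = 1 ∧ IsHyperbolicType (traceForm F R)) ∨ (i = 2 ∧ IsEllipticType (traceForm F R)))}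

/-- `M_{r,i} = #K_{r,i}`. -/
def rankTypeCount (L : Submodule K K[X]) (r i : ℕ) : ℕ := (rankTypeSet F L r i).ncard

open Classical in
/-- The set of ranks of the forms `Q_R`, `R ∈ L` (a rank is at most `[K : F]`). -/
def rankSet (L : Submodule K K[X]) : Finset ℕ :=
  (Finset.range (finrank F K + 1)).filter fun r => ∃ R ∈ L, HasRank (traceForm F R) r

/-- `C_L = {(Tr(x R(x)))_{x ∈ Kˣ} : R ∈ L}`. -/
def code (L : Submodule K K[X]) : Submodule F (Kˣ → F) where
  carrier := {c | ∃ R ∈ L, c = fun x : Kˣ => traceForm F R x}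
  zero_mem' := ⟨0, L.zero_mem, by ext x; simp [traceForm]⟩
  add_mem' := by
    rintro _ _ ⟨R, hR, rfl⟩ ⟨S, hS, rfl⟩
    exact ⟨R + S, L.add_mem hR hS, by ext x; simp [traceForm, mul_add]⟩
  smul_mem' := by
    rintro a _ ⟨R, hR, rfl⟩
    refine ⟨algebraMap F K a • R, L.smul_mem _ hR, ?_⟩
    ext x
    simp only [traceForm, Pi.smul_apply, Polynomial.eval_smul, ← map_smul]
    rw [algebraMap_smul, mul_smul_comm]

/-- `C_{L,0} = {(Tr(x R(x)) + b)_{x ∈ Kˣ} : R ∈ L, b ∈ F}`. -/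
def code₀ (L : Submodule K K[X]) : Submodule F (Kˣ → F) where
  carrier := {c | ∃ R ∈ L, ∃ b : F, c = fun x : Kˣ => traceForm F R x + b}
  zero_mem' := ⟨0, L.zero_mem, 0, by ext x; simp [traceForm]⟩
  add_mem' := by
    rintro _ _ ⟨R, hR, a, rfl⟩ ⟨S, hS, b, rfl⟩
    exact ⟨R + S, L.add_mem hR hS, a + b, by ext x; simp [traceForm, mul_add]; ring⟩
  smul_mem' := by
    rintro a _ ⟨R, hR, b, rfl⟩
    refine ⟨algebraMap F K a • R, L.smul_mem _ hR, a * b, ?_⟩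
    ext x
    simp only [traceForm, Pi.smul_apply, Polynomial.eval_smul]
    rw [algebraMap_smul, mul_smul_comm, map_smul]
    simp only [smul_eq_mul, mul_add]

/-- A code with coordinates indexed by `Kˣ`, written as a code of length `n` through the
enumeration `α⁰, α¹, …, αⁿ⁻¹` of the coordinates. -/
def orderBy (α : Kˣ) (n : ℕ) (C : Submodule F (Kˣ → F)) : Submodule F (Fin n → F) :=
  C.map (LinearMap.funLeft F F fun i : Fin n => α ^ (i : ℕ))

end TraceForms

end TraceCode

end

/-! Splitting off hyperbolic planes, which exist by Chevalley-Warning as long as more than two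
dimensions remain outside the radical, shows that an even rank form over a finite field has exactly
one type. All its fibres over nonzero values have the same size, and the excess of the zero fibre is
multiplicative on orthogonal sums: it is `q` for a hyperbolic plane, `-q` for an anisotropic one
(where a second moment count has variance zero) and `q ^ d` for a `d`-dimensional radical. So rank
and type determine every weight.

For the dimensions, if `Q_R` vanishes then `R` plus its adjoint for the trace form is zero. The
Frobenius exponents `ℓ j` of `R` and `m - ℓ j` of its adjoint are distinct, so `R = 0` by Dedekind's
independence of characters. A nonzero constant is not of the form `Q_R`, as `Q_R` has a zero in
`Kˣ`, again by Chevalley-Warning. -/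

open scoped Finset

namespace TraceCode

section Excess

/-- The fibres of `f : X → A` over the nonzero elements of `A` all have the same size, and the fibre
over zero has `b` more elements. This is expressed without division: counting `X` forces the common
size to be `(#X - b) / #A`. -/
def HasExcess {A X : Type*} [AddCommGroup A] [Fintype A] [DecidableEq A] [Fintype X] (f : X → A)
    (b : ℤ) : Prop :=
  ∀ c, (Fintype.card A : ℤ) * #{x | f x = c} =
    Fintype.card X - b + if c = 0 then (Fintype.card A : ℤ) * b else 0

theorem card_filter_prod {X Y : Type*} [Fintype X] [Fintype Y] (P : X × Y → Prop)
    [DecidablePred P] : #{p | P p} = ∑ x, #{y | P (x, y)} := by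
  simp only [Finset.card_filter, Fintype.sum_prod_type]

variable {A X Y : Type*} [AddCommGroup A] [Fintype A] [DecidableEq A] [Fintype X] [Fintype Y]

theorem HasExcess.of_equiv {f : X → A} {g : Y → A} {b : ℤ} (h : HasExcess f b) (e : Y ≃ X)
    (hg : ∀ y, g y = f (e y)) : HasExcess g b := by
  intro c
  have hfiber : #{y | g y = c} = #{x | f x = c} := Finset.card_equiv e (by simp [hg])
  rw [hfiber, Fintype.card_congr e, h c]

theorem HasExcess.unique [Nontrivial A] {f : X → A} {a b : ℤ} (ha : HasExcess f a)
    (hb : HasExcess f b) : a = b := by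
  obtain ⟨c, hc⟩ := exists_ne (0 : A)
  simpa [hc] using (ha c).symm.trans (hb c)

theorem HasExcess.add {f : X → A} {g : Y → A} {a b : ℤ} (hf : HasExcess f a)
    (hg : HasExcess g b) : HasExcess (fun p : X × Y => f p.1 + g p.2) (a * b) := by
  intro c
  have hslice (x : X) : (Fintype.card A : ℤ) * #{y | f x + g y = c} =
      Fintype.card Y - b + Fintype.card A * b * if f x = c then 1 else 0 := by
    simpa only [eq_sub_iff_add_eq', sub_eq_zero, eq_comm (a := c), mul_ite, mul_one, mul_zero]
      using hg (c - f x)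
  calc (Fintype.card A : ℤ) * #{p : X × Y | f p.1 + g p.2 = c}
      = ∑ x, (Fintype.card A : ℤ) * #{y | f x + g y = c} := by
        rw [card_filter_prod, Nat.cast_sum, Finset.mul_sum]
    _ = Fintype.card X * (Fintype.card Y - b) + b * (Fintype.card A * #{x | f x = c}) := by
        simp only [hslice, Finset.sum_add_distrib, ← Finset.mul_sum, Finset.sum_boole,
          Finset.sum_const, Finset.card_univ, nsmul_eq_mul]
        ring
    _ = _ := by
        rw [hf c, Fintype.card_prod, Nat.cast_mul]
        split_ifs <;> ring

theorem hasExcess_zero : HasExcess (fun _ : X => (0 : A)) (Fintype.card X) := by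
  intro c
  by_cases hc : c = 0
  · simp [hc]
  · simp [hc, Ne.symm hc]

variable {F : Type*} [Field F] [Fintype F] [DecidableEq F]

theorem hasExcess_mul : HasExcess (fun p : F × F => p.1 * p.2) (Fintype.card F) := by
  intro c
  have hslice (u : F) : (#{v | u * v = c} : ℤ) =
      1 + if u = 0 then ((if c = 0 then (Fintype.card F : ℤ) else 0) - 1) else 0 := by
    rcases eq_or_ne u 0 with rfl | hu
    · by_cases hc : c = 0
      · simp [hc]
      · simp [hc, Ne.symm hc]
    · simp [hu, ← eq_inv_mul_iff_mul_eq₀ hu, Finset.filter_eq']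
  rw [card_filter_prod, Nat.cast_sum]
  simp only [hslice, Finset.sum_add_distrib, Finset.sum_const, Finset.card_univ, nsmul_eq_mul,
    mul_one, Fintype.card_prod, Nat.cast_mul, Finset.sum_ite_eq', Finset.mem_univ, if_true]
  split_ifs <;> ring

theorem hasExcess_sum_mul (k : ℕ) :
    HasExcess (fun x : Fin k → F × F => ∑ i, (x i).1 * (x i).2) ((Fintype.card F : ℤ) ^ k) := by
  induction k with
  | zero => simpa using hasExcess_zero (A := F) (X := Fin 0 → F × F)
  | succ k ih =>
    rw [pow_succ']
    exact (hasExcess_mul.add ih).of_equiv (Fin.consEquiv fun _ : Fin (k + 1) => F × F).symm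
      fun _ => Fin.sum_univ_succ _

end Excess

section Anisotropic

theorem sum_card_fiber_sq {V A : Type*} [AddCommGroup V] [Fintype V] [AddCommGroup A] [Fintype A]
    [DecidableEq A] (f : V → A) :
    ∑ c, #{x | f x = c} ^ 2 = ∑ t, #{x | QuadraticMap.polar f t x = -f t} := by
  -- Both sides count the pairs `(x, y)` with `f x = f y`; on the right, `y = t + x`.
  have hpolar (t x : V) : QuadraticMap.polar f t x = -f t ↔ f (t + x) = f x := by
    rw [QuadraticMap.polar, sub_sub, sub_eq_iff_eq_add, neg_add_cancel_left]
  calc ∑ c, #{x | f x = c} ^ 2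
      = ∑ c, ∑ x, ∑ y, if f x = c ∧ f y = c then 1 else 0 := by
        simp only [Finset.card_filter, sq, Finset.sum_mul_sum, ite_and, ite_mul, one_mul, zero_mul]
    _ = ∑ x, ∑ y, ∑ c, if f x = c ∧ f y = c then 1 else 0 := by
        rw [Finset.sum_comm]
        exact Finset.sum_congr rfl fun _ _ => Finset.sum_comm
    _ = ∑ x, ∑ y, if f y = f x then 1 else 0 := by simp [ite_and]
    _ = ∑ x, ∑ t, if f (t + x) = f x then 1 else 0 :=
        Finset.sum_congr rfl fun x _ =>
          (Equiv.sum_comp (Equiv.addRight x) fun y => if f y = f x then 1 else 0).symm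
    _ = _ := by
        rw [Finset.sum_comm]
        simp only [hpolar, Finset.card_filter]

variable {F V : Type*} [Field F] [AddCommGroup V] [Module F V]

theorem card_mul_card_fiber_of_ne_zero [Fintype F] [DecidableEq F] [Fintype V] {φ : V →ₗ[F] F}
    (hφ : φ ≠ 0) (a : F) : Fintype.card F * #{x | φ x = a} = Fintype.card V := by
  have hmem (c : F) : c ∈ Set.range φ := LinearMap.surjective hφ c
  have hconst (c : F) : #{x | φ x = c} = #{x | φ x = a} :=
    AddMonoidHom.card_fiber_eq_of_mem_range φ.toAddMonoidHom (hmem c) (hmem a)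
  calc Fintype.card F * #{x | φ x = a}
      = ∑ c, #{x | φ x = c} := by simp [hconst]
    _ = Fintype.card V :=
        (Finset.card_eq_sum_card_fiberwise fun _ _ => Finset.mem_coe.2 (Finset.mem_univ _)).symm

variable {N : QuadraticForm F V}

theorem polarBilin_ne_zero_of_anisotropic [Finite F] (hN : N.Anisotropic) (hV : 1 < finrank F V)
    {t : V} (ht : t ≠ 0) : N.polarBilin t ≠ 0 := by
  intro hzero
  have hpolar (w : V) : QuadraticMap.polar N t w = 0 := LinearMap.congr_fun hzero w
  have hNt : N t ≠ 0 := fun h => ht (hN t h)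
  have htwo : (2 : F) = 0 := by simpa [QuadraticMap.polar_self, hNt] using hpolar t
  have hchar : CharP F 2 := CharTwo.of_one_ne_zero_of_two_eq_zero one_ne_zero htwo
  obtain ⟨u, hu⟩ : ∃ u, u ∉ Submodule.span F {t} := by
    by_contra! hspan
    have hline := finrank_span_singleton (K := F) ht
    rw [(Submodule.eq_top_iff' (p := Submodule.span F {t})).2 hspan, finrank_top] at hline
    omega
  -- In characteristic two `N u / N t` is a square, so the line `u + F t` contains a zero of `N`.
  obtain ⟨γ, hγ⟩ := FiniteField.isSquare_of_char_two (ringChar.eq_iff.2 hchar) (N u / N t)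
  have hisotropic : N (γ • t + u) = 0 := by
    rw [QuadraticMap.map_add N, QuadraticMap.map_smul, QuadraticMap.polar_smul_left, hpolar u,
      smul_zero, add_zero, smul_eq_mul, ← hγ, div_mul_cancel₀ _ hNt, ← two_mul, htwo, zero_mul]
  refine hu (Submodule.mem_span_singleton.2 ⟨-γ, ?_⟩)
  rw [neg_smul]
  exact neg_eq_of_add_eq_zero_right (hN _ hisotropic)

variable [Fintype F] [DecidableEq F] [Fintype V]

theorem sum_card_fiber_sq_of_anisotropic (hN : N.Anisotropic) (hV : finrank F V = 2) :
    ∑ c, (#{x | N x = c} : ℤ) ^ 2 =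
      (Fintype.card F : ℤ) ^ 3 + (Fintype.card F : ℤ) ^ 2 - Fintype.card F := by
  classical
  have hcard : Fintype.card V = Fintype.card F ^ 2 := by rw [card_eq_pow_finrank (K := F), hV]
  have hfiber (t : V) : (#{x | QuadraticMap.polar N t x = -N t} : ℤ) =
      Fintype.card F + if t = 0 then (Fintype.card F : ℤ) ^ 2 - Fintype.card F else 0 := by
    by_cases ht : t = 0
    · simp [ht, hcard]
    · have := card_mul_card_fiber_of_ne_zero
        (polarBilin_ne_zero_of_anisotropic hN (by omega) ht) (-N t)
      rw [hcard, sq] at this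
      simpa [ht] using Nat.eq_of_mul_eq_mul_left Fintype.card_pos this
  have hsum := congrArg (Nat.cast (R := ℤ)) (sum_card_fiber_sq N)
  push_cast at hsum
  rw [hsum]
  simp only [hfiber, Finset.sum_add_distrib, Finset.sum_const, Finset.card_univ, hcard,
    Finset.sum_ite_eq', Finset.mem_univ, if_true, nsmul_eq_mul, Nat.cast_pow]
  ring

theorem hasExcess_of_anisotropic (hN : N.Anisotropic) (hV : finrank F V = 2) :
    HasExcess N (-(Fintype.card F : ℤ)) := by
  set q : ℤ := (Fintype.card F : ℤ)
  set n : F → ℤ := fun c => #{x | N x = c}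
  have hcard : (Fintype.card V : ℤ) = q ^ 2 := by
    rw [card_eq_pow_finrank (K := F), hV, Nat.cast_pow]
  have hzero : n 0 = 1 := by
    have hfiber : ({x | N x = 0} : Finset V) = {0} := by
      ext x
      simp [hN.eq_zero_iff]
    simp only [n, hfiber, Finset.card_singleton, Nat.cast_one]
  have hmean : ∑ c, n c = q ^ 2 := by
    rw [← hcard, ← Finset.card_univ, Finset.card_eq_sum_card_fiberwise (f := N) (t := Finset.univ)
      (by simp), Nat.cast_sum]
  have hvariance : ∑ c : F, (if c = 0 then 0 else (n c - (q + 1)) ^ 2) = 0 := by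
    have hterm (c : F) : (if c = 0 then 0 else (n c - (q + 1)) ^ 2) =
        n c ^ 2 - 2 * (q + 1) * n c + (q + 1) ^ 2 - if c = 0 then q ^ 2 else 0 := by
      split_ifs with hc
      · rw [hc, hzero]; ring
      · ring
    simp only [hterm, Finset.sum_sub_distrib, Finset.sum_add_distrib, ← Finset.mul_sum, hmean,
      n, sum_card_fiber_sq_of_anisotropic hN hV, Finset.sum_const, Finset.card_univ, nsmul_eq_mul,
      Finset.sum_ite_eq', Finset.mem_univ, if_true]
    ring
  have hfiber (c : F) (hc : c ≠ 0) : n c = q + 1 := by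
    have := (Finset.sum_eq_zero_iff_of_nonneg fun c _ => by split_ifs <;> positivity).1
      hvariance c (Finset.mem_univ c)
    rwa [if_neg hc, sq_eq_zero_iff, sub_eq_zero] at this
  intro c
  change q * n c = _
  rw [hcard]
  split_ifs with hc
  · rw [hc, hzero]; ring
  · rw [hfiber c hc]; ring

end Anisotropic

section ChevalleyWarning

variable {F : Type*} [Field F]

theorem exists_ne_zero_eval_eq_zero [Finite F] {ι : Type*} [Fintype ι] {f : MvPolynomial ι F}
    (hdeg : f.totalDegree < Fintype.card ι) (hf : MvPolynomial.eval 0 f = 0) :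
    ∃ x ≠ 0, MvPolynomial.eval x f = 0 := by
  classical
  have := Fintype.ofFinite F
  obtain ⟨p, _⟩ := CharP.exists F
  have hcard : Fintype.card {x // MvPolynomial.eval x f = 0} ≠ 1 := fun h =>
    CharP.char_ne_one F p (Nat.dvd_one.1 (h ▸ char_dvd_card_solutions p hdeg))
  by_contra! hall
  exact hcard (Fintype.card_eq_one_iff.2
    ⟨⟨0, hf⟩, fun x => Subtype.ext (by_contra fun hx => hall x hx x.2)⟩)

variable {V : Type*} [AddCommGroup V] [Module F V]

theorem exists_mvPolynomial_eval_eq {ι : Type*} [Fintype ι] (Q : QuadraticForm F V)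
    (b : Basis ι F V) :
    ∃ f : MvPolynomial ι F, f.totalDegree ≤ 2 ∧
      ∀ x, MvPolynomial.eval x f = Q (∑ i, x i • b i) := by
  obtain ⟨B, rfl⟩ := LinearMap.BilinMap.toQuadraticMap_surjective Q
  refine ⟨∑ i, ∑ j, MvPolynomial.C (B (b i) (b j)) * (MvPolynomial.X i * MvPolynomial.X j), ?_,
    fun x => ?_⟩
  · refine MvPolynomial.totalDegree_finsetSum_le fun i _ =>
      MvPolynomial.totalDegree_finsetSum_le fun j _ => ?_
    refine (MvPolynomial.totalDegree_mul _ _).trans ?_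
    rw [MvPolynomial.totalDegree_C, zero_add]
    exact (MvPolynomial.totalDegree_mul _ _).trans (by simp)
  · simp only [LinearMap.BilinMap.toQuadraticMap_apply, map_sum, map_mul,
      MvPolynomial.eval_C, MvPolynomial.eval_X, LinearMap.sum_apply, map_smul,
      LinearMap.smul_apply, smul_eq_mul, Finset.mul_sum]
    rw [Finset.sum_comm]
    exact Finset.sum_congr rfl fun i _ => Finset.sum_congr rfl fun j _ => by ring

theorem exists_ne_zero_map_eq_zero [Finite F] (Q : QuadraticForm F V) (hV : 2 < finrank F V) :
    ∃ v ≠ 0, Q v = 0 := by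
  have : FiniteDimensional F V := FiniteDimensional.of_finrank_pos (by omega)
  let b := finBasis F V
  obtain ⟨f, hdeg, hf⟩ := exists_mvPolynomial_eval_eq Q b
  obtain ⟨x, hx, hfx⟩ := exists_ne_zero_eval_eq_zero
    (hdeg.trans_lt (by rwa [Fintype.card_fin])) (by rw [hf]; simp)
  refine ⟨∑ i, x i • b i, fun hz => hx (funext ?_), hf x ▸ hfx⟩
  exact Fintype.linearIndependent_iff.1 b.linearIndependent x hz

end ChevalleyWarning

section HyperbolicSplitting

variable {F V : Type*} [Field F] [AddCommGroup V] [Module F V]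

theorem mem_radical_iff_polar {Q : QuadraticForm F V} {y : V} :
    y ∈ Q.radical ↔ Q y = 0 ∧ ∀ x, QuadraticMap.polar Q y x = 0 :=
  and_congr_right fun _ => LinearMap.ext_iff

theorem exists_hyperbolic_pair {Q : QuadraticForm F V} {v : V} (hv : Q v = 0)
    (hvrad : v ∉ Q.radical) : ∃ w, Q w = 0 ∧ QuadraticMap.polar Q v w = 1 := by
  obtain ⟨x, hx⟩ : ∃ x, QuadraticMap.polar Q v x ≠ 0 := by
    by_contra! hall
    exact hvrad (mem_radical_iff_polar.2 ⟨hv, hall⟩)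
  obtain ⟨y, hvy⟩ : ∃ y, QuadraticMap.polar Q v y = 1 :=
    ⟨(QuadraticMap.polar Q v x)⁻¹ • x, by simp [QuadraticMap.polar_smul_right, hx]⟩
  refine ⟨y + (-Q y) • v, ?_, ?_⟩
  · simp [QuadraticMap.map_add Q, QuadraticMap.map_smul, QuadraticMap.polar_smul_right,
      QuadraticMap.polar_comm Q y v, hvy, hv]
  · simp [QuadraticMap.polar_add_right, QuadraticMap.polar_smul_right, hvy,
      QuadraticMap.polar_self, hv]

theorem bijective_coprod_ker_subtype {P : Type*} [AddCommGroup P] [Module F P] {p : V →ₗ[F] P}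
    {s : P →ₗ[F] V} (hps : ∀ a, p (s a) = a) :
    Function.Bijective (s.coprod p.ker.subtype) := by
  constructor
  · rw [← LinearMap.ker_eq_bot, LinearMap.ker_eq_bot']
    rintro ⟨a, u⟩ h
    have hsum : s a + u = 0 := h
    obtain rfl : a = 0 := by simpa [hps] using congrArg p hsum
    simpa using hsum
  · exact fun x => ⟨(p x, ⟨x - s (p x), by simp [hps]⟩), by simp⟩

/-- The orthogonal complement, for the polar form of `Q`, of the plane spanned by `v` and `w`.
The polar forms with `w` and `v`, in this order, are the coordinates on the plane if `v, w` is a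
hyperbolic pair. -/
def orthPair (Q : QuadraticForm F V) (v w : V) : Submodule F V :=
  ((Q.polarBilin w).prod (Q.polarBilin v)).ker

variable {Q : QuadraticForm F V} {v w : V}

theorem mem_orthPair {x : V} :
    x ∈ orthPair Q v w ↔ QuadraticMap.polar Q v x = 0 ∧ QuadraticMap.polar Q w x = 0 := by
  simp [orthPair, and_comm]

theorem radical_le_orthPair : Q.radical ≤ orthPair Q v w := fun y hy => by
  have hpolar := (mem_radical_iff_polar.1 hy).2
  exact mem_orthPair.2 ⟨QuadraticMap.polar_comm Q v y ▸ hpolar v,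
    QuadraticMap.polar_comm Q w y ▸ hpolar w⟩

variable (hv : Q v = 0) (hw : Q w = 0) (hvw : QuadraticMap.polar Q v w = 1)

/-- The decomposition of `V` into the hyperbolic plane spanned by a hyperbolic pair `v, w` and its
orthogonal complement; the coordinates `(a, b)` on the plane are those of `a • v + b • w`. -/
noncomputable def hyperbolicSplitting : V ≃ₗ[F] (F × F) × orthPair Q v w :=
  .symm <| .ofBijective
    (((LinearMap.toSpanSingleton F V v).coprod (LinearMap.toSpanSingleton F V w)).coprod
      (orthPair Q v w).subtype) <|
    bijective_coprod_ker_subtype fun _ => by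
      simp [QuadraticMap.polar_self, QuadraticMap.polar_comm Q w v, hv, hw, hvw]

theorem hyperbolicSplitting_symm_apply (a b : F) (u : orthPair Q v w) :
    (hyperbolicSplitting hv hw hvw).symm ((a, b), u) = a • v + b • w + u :=
  rfl

theorem map_eq_hyperbolicSplitting (x : V) :
    Q x = (hyperbolicSplitting hv hw hvw x).1.1 * (hyperbolicSplitting hv hw hvw x).1.2 +
      Q.comp (orthPair Q v w).subtype (hyperbolicSplitting hv hw hvw x).2 := by
  obtain ⟨⟨⟨a, b⟩, u⟩, rfl⟩ := (hyperbolicSplitting hv hw hvw).symm.surjective x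
  obtain ⟨hvu, hwu⟩ := mem_orthPair.1 u.2
  rw [LinearEquiv.apply_symm_apply, hyperbolicSplitting_symm_apply, QuadraticMap.map_add Q,
    QuadraticMap.map_add Q, QuadraticMap.polar_add_left]
  simp [QuadraticMap.polar_smul_left, QuadraticMap.polar_smul_right, hvu, hwu, hvw,
    QuadraticMap.map_smul, hv, hw, mul_comm]

include hv hw hvw in
theorem radical_comp_orthPair_subtype :
    (Q.comp (orthPair Q v w).subtype).radical = Q.radical.comap (orthPair Q v w).subtype := by
  ext u
  simp only [Submodule.mem_comap, mem_radical_iff_polar]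
  refine and_congr_right fun _ => ⟨fun hu x => ?_, fun hu x => hu x⟩
  obtain ⟨⟨⟨a, b⟩, t⟩, rfl⟩ := (hyperbolicSplitting hv hw hvw).symm.surjective x
  obtain ⟨hvu, hwu⟩ := mem_orthPair.1 u.2
  have hut : QuadraticMap.polar Q u t = 0 := hu t
  rw [QuadraticMap.polar_comm] at hvu hwu
  simp [hyperbolicSplitting_symm_apply, QuadraticMap.polar_add_right,
    QuadraticMap.polar_smul_right, hvu, hwu, hut]

include hv hw hvw in
theorem finrank_radical_comp_orthPair_subtype :
    finrank F (Q.comp (orthPair Q v w).subtype).radical = finrank F Q.radical := by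
  rw [radical_comp_orthPair_subtype hv hw hvw]
  exact (Submodule.comapSubtypeEquivOfLe radical_le_orthPair).finrank_eq

end HyperbolicSplitting

section Types

variable {F V : Type*} [Field F] [AddCommGroup V] [Module F V]

/-- The function `Q` is a quadratic form of type `+1` (for `i = 1`) or `-1` (for `i = 2`), so its
type is the sign `(-1) ^ (i + 1)`. -/
def HasType (Q : V → F) (i : ℕ) : Prop :=
  (i = 1 ∧ IsHyperbolicType Q) ∨ (i = 2 ∧ IsEllipticType Q)

theorem HasType.mem {Q : V → F} {i : ℕ} (h : HasType Q i) : i ∈ ({1, 2} : Finset ℕ) := by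
  rcases h with ⟨rfl, _⟩ | ⟨rfl, _⟩ <;> simp

variable {U : Type*} [AddCommGroup U] [Module F U] {Q : V → F} {Q' : U → F}

theorem IsHyperbolicType.of_hyperbolic_add (h : IsHyperbolicType Q') (E : V ≃ₗ[F] (F × F) × U)
    (hE : ∀ x, Q x = (E x).1.1 * (E x).1.2 + Q' (E x).2) : IsHyperbolicType Q := by
  obtain ⟨k, d, e, he⟩ := h
  refine ⟨k + 1, d, (E.trans ((LinearEquiv.refl F (F × F)).prodCongr e)).trans
    ((LinearEquiv.prodAssoc F (F × F) (Fin k → F × F) (Fin d → F)).symm.trans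
      ((Fin.consLinearEquiv F fun _ : Fin (k + 1) => F × F).prodCongr
        (LinearEquiv.refl F (Fin d → F)))), fun x => ?_⟩
  rw [hE, he, Fin.sum_univ_succ]
  rfl

theorem IsEllipticType.of_hyperbolic_add (h : IsEllipticType Q') (E : V ≃ₗ[F] (F × F) × U)
    (hE : ∀ x, Q x = (E x).1.1 * (E x).1.2 + Q' (E x).2) : IsEllipticType Q := by
  obtain ⟨k, d, N, e, hN, he⟩ := h
  refine ⟨k + 1, d, N, (E.trans ((LinearEquiv.refl F (F × F)).prodCongr e)).trans
    ((LinearEquiv.prodAssoc F (F × F) (Fin k → F × F) ((F × F) × (Fin d → F))).symm.trans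
      ((Fin.consLinearEquiv F fun _ : Fin (k + 1) => F × F).prodCongr
        (LinearEquiv.refl F ((F × F) × (Fin d → F))))), hN, fun x => ?_⟩
  rw [hE, he, Fin.sum_univ_succ, ← add_assoc]
  rfl

theorem HasType.of_hyperbolic_add {i : ℕ} (h : HasType Q' i) (E : V ≃ₗ[F] (F × F) × U)
    (hE : ∀ x, Q x = (E x).1.1 * (E x).1.2 + Q' (E x).2) : HasType Q i :=
  h.imp (And.imp_right fun h => h.of_hyperbolic_add E hE)
    (And.imp_right fun h => h.of_hyperbolic_add E hE)

theorem isHyperbolicType_of_forall_eq_zero [FiniteDimensional F V] (hQ : ∀ x, Q x = 0) :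
    IsHyperbolicType Q :=
  ⟨0, finrank F V, (LinearEquiv.ofFinrankEq V (Fin (finrank F V) → F) (by simp)).trans
    (LinearEquiv.uniqueProd (M₂ := Fin 0 → F × F)).symm, fun x => by simp [hQ x]⟩

theorem isEllipticType_of_anisotropic [FiniteDimensional F U] {W : Type*} [AddCommGroup W]
    [Module F W] {N : QuadraticForm F W} (hN : N.Anisotropic) (hW : finrank F W = 2)
    (E : V ≃ₗ[F] W × U) (hE : ∀ x, Q x = N (E x).1) : IsEllipticType Q := by
  have : FiniteDimensional F W := FiniteDimensional.of_finrank_pos (by omega)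
  let eW : W ≃ₗ[F] F × F := LinearEquiv.ofFinrankEq _ _ (by simp [hW])
  let eU : U ≃ₗ[F] (Fin (finrank F U) → F) := LinearEquiv.ofFinrankEq _ _ (by simp)
  refine ⟨0, finrank F U, N.comp eW.symm.toLinearMap, (E.trans (eW.prodCongr eU)).trans
    (LinearEquiv.uniqueProd (M₂ := Fin 0 → F × F)).symm,
    fun x hx => eW.symm.map_eq_zero_iff.1 (hN _ hx), fun x => ?_⟩
  simp [hE]

theorem exists_anisotropic_prod_radical {Q : QuadraticForm F V}
    (hQ : ∀ v, Q v = 0 → v ∈ Q.radical) :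
    ∃ (W : Submodule F V) (E : V ≃ₗ[F] W × Q.radical),
      (Q.comp W.subtype).Anisotropic ∧ ∀ x, Q x = Q.comp W.subtype (E x).1 := by
  obtain ⟨W, hW⟩ := Submodule.exists_isCompl Q.radical
  refine ⟨W, (W.prodEquivOfIsCompl Q.radical hW.symm).symm, fun w hw => ?_, fun x => ?_⟩
  · exact Subtype.ext (Submodule.disjoint_def.1 hW.disjoint _ (hQ w hw) w.2)
  · obtain ⟨⟨w, y⟩, rfl⟩ := (W.prodEquivOfIsCompl Q.radical hW.symm).surjective x
    rw [LinearEquiv.symm_apply_apply, Submodule.coe_prodEquivOfIsCompl', add_comm]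
    exact (QuadraticMap.mem_radical_iff'.1 y.2).2 w

theorem HasRank.unique {Q : V → F} {r r' : ℕ} (h : HasRank Q r) (h' : HasRank Q r') : r = r' := by
  obtain ⟨B, hB, rfl⟩ := h
  obtain ⟨B', hB', rfl⟩ := h'
  obtain rfl : B = B' := QuadraticMap.ext fun x => (hB x).trans (hB' x).symm
  rfl

theorem HasRank.le_finrank [FiniteDimensional F V] {Q : V → F} {r : ℕ} (h : HasRank Q r) :
    r ≤ finrank F V := by
  obtain ⟨B, -, rfl⟩ := h
  exact B.radical.finrank_quotient_le

theorem HasRank.map_zero {Q : V → F} {r : ℕ} (h : HasRank Q r) : Q 0 = 0 := by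
  obtain ⟨B, hB, -⟩ := h
  rw [← hB, QuadraticMap.map_zero]

end Types

section Classification

variable {F V : Type*} [Field F] [AddCommGroup V] [Module F V]

theorem HasType.exists_hasExcess [Fintype F] [DecidableEq F] [Fintype V] {Q : V → F} {i : ℕ}
    (h : HasType Q i) :
    ∃ n, HasExcess Q ((-1) ^ (i + 1) * (Fintype.card F : ℤ) ^ n) := by
  rcases h with ⟨rfl, k, d, e, he⟩ | ⟨rfl, k, d, N, e, hN, he⟩
  · refine ⟨k + d, ?_⟩
    convert ((hasExcess_sum_mul k).add (hasExcess_zero (X := Fin d → F))).of_equiv e.toEquiv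
      fun x => (he x).trans (by simp) using 1
    simp [pow_add]
  · refine ⟨k + 1 + d, ?_⟩
    convert ((hasExcess_sum_mul k).add ((hasExcess_of_anisotropic hN (by simp)).add
      (hasExcess_zero (X := Fin d → F)))).of_equiv e.toEquiv
      fun x => (he x).trans (by simp) using 1
    simp [pow_add, mul_assoc]

theorem HasType.unique [Finite F] [Finite V] {Q : V → F} {i j : ℕ} (hi : HasType Q i)
    (hj : HasType Q j) : i = j := by
  classical
  have := Fintype.ofFinite F
  have := Fintype.ofFinite V
  obtain ⟨n, hn⟩ := hi.exists_hasExcess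
  obtain ⟨n', hn'⟩ := hj.exists_hasExcess
  have hexcess := hn.unique hn'
  have hq : (0 : ℤ) < Fintype.card F := by exact_mod_cast Fintype.card_pos
  have hpos := pow_pos hq n
  have hpos' := pow_pos hq n'
  rcases hi with ⟨rfl, -⟩ | ⟨rfl, -⟩ <;> rcases hj with ⟨rfl, -⟩ | ⟨rfl, -⟩ <;> first | rfl | omega

variable [Fintype F] [DecidableEq F] [Fintype V]

theorem isEllipticType_and_hasExcess_of_forall_mem_radical {Q : QuadraticForm F V} {h : ℕ}
    (hQ : ∀ v, Q v = 0 → v ∈ Q.radical)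
    (hrank : finrank F V = 2 * (h + 1) + finrank F Q.radical) :
    IsEllipticType Q ∧ HasExcess Q (-(Fintype.card F : ℤ) ^ (h + 1 + finrank F Q.radical)) := by
  classical
  obtain ⟨W, E, hW, hE⟩ := exists_anisotropic_prod_radical hQ
  have hdim := E.finrank_eq
  rw [finrank_prod] at hdim
  have hle : finrank F W ≤ 2 := by
    by_contra! hlt
    obtain ⟨w, hw, hQw⟩ := exists_ne_zero_map_eq_zero (Q.comp W.subtype) hlt
    exact hw (hW w hQw)
  obtain rfl : h = 0 := by omega
  have hW2 : finrank F W = 2 := by omega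
  have := Fintype.ofFinite Q.radical
  refine ⟨isEllipticType_of_anisotropic hW hW2 E hE, ?_⟩
  convert ((hasExcess_of_anisotropic hW hW2).add (hasExcess_zero (X := Q.radical))).of_equiv
    E.toEquiv fun x => (hE x).trans (add_zero _).symm using 1
  rw [card_eq_pow_finrank (K := F) (V := Q.radical)]
  push_cast
  ring

theorem exists_hasType_and_hasExcess (h : ℕ) {Q : QuadraticForm F V}
    (hrank : finrank F V = 2 * h + finrank F Q.radical) :
    ∃ i, HasType Q i ∧
      HasExcess Q ((-1) ^ (i + 1) * (Fintype.card F : ℤ) ^ (h + finrank F Q.radical)) := by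
  classical
  induction h generalizing V with
  | zero =>
    have htop : Q.radical = ⊤ := Submodule.eq_top_of_finrank_eq (by omega)
    have hQ (x : V) : Q x = 0 := (htop ▸ Submodule.mem_top : x ∈ Q.radical).1
    refine ⟨1, .inl ⟨rfl, isHyperbolicType_of_forall_eq_zero hQ⟩, ?_⟩
    convert (hasExcess_zero (A := F)).of_equiv (Equiv.refl V) hQ using 1
    simp [card_eq_pow_finrank (K := F) (V := V), hrank]
  | succ h ih =>
    by_cases hQ : ∀ v, Q v = 0 → v ∈ Q.radical
    · obtain ⟨htype, hexcess⟩ := isEllipticType_and_hasExcess_of_forall_mem_radical hQ hrank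
      exact ⟨2, .inr ⟨rfl, htype⟩, by simpa [pow_succ] using hexcess⟩
    push Not at hQ
    obtain ⟨v, hv, hvrad⟩ := hQ
    obtain ⟨w, hw, hvw⟩ := exists_hyperbolic_pair hv hvrad
    let E := hyperbolicSplitting hv hw hvw
    have hE := map_eq_hyperbolicSplitting hv hw hvw
    have hrad := finrank_radical_comp_orthPair_subtype hv hw hvw
    have hdim := E.finrank_eq
    rw [finrank_prod, finrank_prod, finrank_self] at hdim
    obtain ⟨i, htype, hexcess⟩ := ih (Q := Q.comp (orthPair Q v w).subtype) (by omega)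
    refine ⟨i, htype.of_hyperbolic_add E hE, ?_⟩
    convert (hasExcess_mul.add hexcess).of_equiv E.toEquiv hE using 1
    rw [hrad]
    ring

theorem HasRank.exists_hasType {Q : V → F} {r : ℕ} (h : HasRank Q r) (hr : Even r) :
    ∃ i, HasType Q i ∧
      HasExcess Q ((-1) ^ (i + 1) * (Fintype.card F : ℤ) ^ (finrank F V - r / 2)) := by
  obtain ⟨B, hB, hrank⟩ := h
  obtain ⟨h, rfl⟩ := hr
  have hdim := B.radical.finrank_quotient_add_finrank
  obtain rfl : ⇑B = Q := funext hB
  rw [show finrank F V - (h + h) / 2 = h + finrank F B.radical by omega]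
  exact exists_hasType_and_hasExcess h (by omega)

theorem HasRank.hasExcess {Q : V → F} {r i : ℕ} (h : HasRank Q r) (hr : Even r)
    (hi : HasType Q i) :
    HasExcess Q ((-1) ^ (i + 1) * (Fintype.card F : ℤ) ^ (finrank F V - r / 2)) := by
  obtain ⟨j, hj, hexcess⟩ := h.exists_hasType hr
  rwa [hi.unique hj]

end Classification

section Injectivity

variable {F K : Type*} [Field F] [Fintype F] [Field K] [Algebra F K]

theorem frobeniusAlgHom_pow_apply (n : ℕ) (x : K) :
    (FiniteField.frobeniusAlgHom F K ^ n) x = x ^ Fintype.card F ^ n := by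
  rw [AlgHom.coe_pow, FiniteField.coe_frobeniusAlgHom, pow_iterate]

variable {s : ℕ} {ℓ : Fin s → ℕ}

theorem exists_linearMap_eval_eq {R : K[X]}
    (hR : R ∈ linearizedFamily K (Fintype.card F) ℓ) :
    ∃ φ : K →ₗ[F] K, ∀ x, R.eval x = φ x := by
  obtain ⟨a, rfl⟩ := (Submodule.mem_span_range_iff_exists_fun K).1 hR
  refine ⟨∑ j, a j • (FiniteField.frobeniusAlgHom F K ^ ℓ j).toLinearMap, fun x => ?_⟩
  simp only [eval_finsetSum, eval_smul, eval_pow, eval_X, LinearMap.sum_apply,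
    LinearMap.smul_apply, AlgHom.toLinearMap_apply, frobeniusAlgHom_pow_apply]

theorem exists_quadraticForm_eq_traceForm {R : K[X]}
    (hR : R ∈ linearizedFamily K (Fintype.card F) ℓ) :
    ∃ Q : QuadraticForm F K, ⇑Q = traceForm F R := by
  obtain ⟨φ, hφ⟩ := exists_linearMap_eval_eq hR
  refine ⟨LinearMap.BilinMap.toQuadraticMap ((Algebra.traceForm F K).compl₂ φ), ?_⟩
  ext x
  simp [traceForm, hφ]

theorem exists_unit_traceForm_eq_zero (hpos : ∀ j, 1 ≤ ℓ j) (hlt : ∀ j, 2 * ℓ j < finrank F K)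
    {R : K[X]} (hR : R ∈ linearizedFamily K (Fintype.card F) ℓ) :
    ∃ x : Kˣ, traceForm F R x = 0 := by
  cases isEmpty_or_nonempty (Fin s) with
  | inl _ =>
    obtain rfl : R = 0 := by simpa [linearizedFamily, Set.range_eq_empty] using hR
    exact ⟨1, by simp [traceForm]⟩
  | inr hs =>
    obtain ⟨j⟩ := hs
    obtain ⟨Q, hQ⟩ := exists_quadraticForm_eq_traceForm hR
    obtain ⟨x, hx, hQx⟩ := exists_ne_zero_map_eq_zero Q (by linarith [hpos j, hlt j])
    exact ⟨Units.mk0 x hx, by rw [← hQ, Units.val_mk0, hQx]⟩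

variable [Finite K]

theorem linearIndependent_pow_card_pow {ι : Type*} {n : ι → ℕ} (hn : Function.Injective n)
    (hlt : ∀ i, n i < finrank F K) :
    LinearIndependent K fun i (x : K) => x ^ Fintype.card F ^ n i := by
  -- Dedekind: the powers of the Frobenius automorphism are distinct characters.
  have hpow : Function.Injective fun i =>
      ((FiniteField.frobeniusAlgHom F K ^ n i : K →ₐ[F] K) : K →* K) := by
    intro i j hij
    refine hn (pow_injOn_Iio_orderOf ?_ ?_ (AlgHom.coe_monoidHom_injective hij)) <;>
      simpa [FiniteField.orderOf_frobeniusAlgHom] using hlt _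
  simp only [← frobeniusAlgHom_pow_apply (F := F)]
  exact (linearIndependent_monoidHom K K).comp _ hpow

theorem trace_mul_pow_card_pow {n : ℕ} (hn : n ≤ finrank F K) (a y : K) :
    Algebra.trace F K (a * y ^ Fintype.card F ^ n) =
      Algebra.trace F K (y * a ^ Fintype.card F ^ (finrank F K - n)) := by
  have := Fintype.ofFinite K
  rw [← Algebra.trace_eq_of_algEquiv
    (FiniteField.frobeniusAlgEquivOfAlgebraic F K ^ (finrank F K - n)), AlgEquiv.coe_pow,
    FiniteField.coe_frobeniusAlgEquivOfAlgebraic_iterate]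
  simp only [mul_pow, ← pow_mul, ← pow_add, Nat.add_sub_cancel' hn, ← card_eq_pow_finrank,
    FiniteField.pow_card, mul_comm]

theorem sum_mul_pow_card_pow_add_adjoint_eq_zero (hle : ∀ j, ℓ j ≤ finrank F K) {a : Fin s → K}
    (h : ∀ x, traceForm F (∑ j, a j • (X : K[X]) ^ Fintype.card F ^ ℓ j) x = 0) (x : K) :
    ∑ j, a j * x ^ Fintype.card F ^ ℓ j +
      ∑ j, a j ^ Fintype.card F ^ (finrank F K - ℓ j) *
        x ^ Fintype.card F ^ (finrank F K - ℓ j) = 0 := by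
  have := Fintype.ofFinite K
  obtain ⟨φ, hφ⟩ := exists_linearMap_eval_eq (F := F) (ℓ := ℓ)
    ((Submodule.mem_span_range_iff_exists_fun K).2 ⟨a, rfl⟩)
  have halt : ((Algebra.traceForm F K).compl₂ φ).IsAlt := fun x => by
    simpa [traceForm, hφ] using h x
  have heval (x : K) : φ x = ∑ j, a j * x ^ Fintype.card F ^ ℓ j := by
    simp [← hφ, eval_finsetSum]
  refine (traceForm_nondegenerate F K).2 _ fun y => ?_
  have hpolar : Algebra.trace F K (y * φ x) + Algebra.trace F K (x * φ y) = 0 := by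
    simpa [neg_eq_iff_add_eq_zero] using halt.neg y x
  have hadjoint : Algebra.trace F K (x * φ y) = Algebra.trace F K
      (y * ∑ j, a j ^ Fintype.card F ^ (finrank F K - ℓ j) *
        x ^ Fintype.card F ^ (finrank F K - ℓ j)) := by
    simp only [heval, Finset.mul_sum, map_sum]
    refine Finset.sum_congr rfl fun j _ => ?_
    rw [← mul_assoc, trace_mul_pow_card_pow (hle j), mul_pow, mul_comm (x ^ _)]
  rw [Algebra.traceForm_apply, mul_add, map_add, ← hadjoint, ← heval, hpolar]

theorem eq_zero_of_forall_traceForm_eq_zero (hinj : Function.Injective ℓ) (hpos : ∀ j, 1 ≤ ℓ j)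
    (hlt : ∀ j, 2 * ℓ j < finrank F K) {R : K[X]}
    (hR : R ∈ linearizedFamily K (Fintype.card F) ℓ) (h : ∀ x, traceForm F R x = 0) : R = 0 := by
  obtain ⟨a, rfl⟩ := (Submodule.mem_span_range_iff_exists_fun K).1 hR
  -- The exponents `ℓ j` of `R` lie below `m / 2`, those of its adjoint `m - ℓ j` above.
  have hexponents : Function.Injective (Sum.elim ℓ fun j => finrank F K - ℓ j) := by
    refine hinj.sumElim (fun i j hij => hinj ?_) fun i j => ?_ <;> grind
  have hindep := linearIndependent_pow_card_pow (F := F) (K := K) hexponents <| by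
    rintro (j | j) <;> simp only [Sum.elim_inl, Sum.elim_inr] <;> grind
  have ha (j : Fin s) : a j = 0 := by
    refine Fintype.linearIndependent_iff.1 hindep
      (Sum.elim a fun j => a j ^ Fintype.card F ^ (finrank F K - ℓ j)) ?_ (Sum.inl j)
    ext x
    simpa [Fintype.sum_sum_type] using
      sum_mul_pow_card_pow_add_adjoint_eq_zero (fun j => by grind) h x
  simp [ha]

end Injectivity

section CyclicShift

theorem pow_finRotate_symm {G : Type*} [Group G] {α : G} {n : ℕ} (hα : α ^ n = 1) (i : Fin n) :
    α ^ ((finRotate n).symm i : ℕ) = α⁻¹ * α ^ (i : ℕ) := by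
  obtain ⟨j, rfl⟩ := (finRotate n).surjective i
  have := j.neZero
  rw [Equiv.symm_apply_apply, finRotate_apply, Fin.val_add, ← pow_eq_pow_mod _ hα, pow_add,
    Fin.val_one', ← pow_eq_pow_mod _ hα, pow_one, pow_mul_comm', inv_mul_cancel_left]

variable {F K : Type*} [Field F] [Field K]

theorem isCyclicCode_orderBy {α : Kˣ} {n : ℕ} (hα : α ^ n = 1) {C : Submodule F (Kˣ → F)}
    (hC : ∀ c ∈ C, (fun x => c (α⁻¹ * x)) ∈ C) : IsCyclicCode (orderBy F α n C) := by
  rintro _ ⟨c, hc, rfl⟩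
  refine ⟨_, hC c hc, ?_⟩
  ext i
  simp only [LinearMap.funLeft_apply, pow_finRotate_symm hα]

end CyclicShift

section Codes

variable (F : Type*) {K : Type*} [Field F] [Field K] [Algebra F K] (L : Submodule K K[X])

/-- The parametrization `R ↦ (Tr(x R(x)))ₓ` of the code `code F L`. -/
noncomputable def encode : L →ₗ[F] Kˣ → F where
  toFun R x := traceForm F (R : K[X]) x
  map_add' R S := by
    ext x
    simp [traceForm, mul_add]
  map_smul' a R := by
    ext x
    simp [traceForm]

/-- The parametrization `(R, b) ↦ (Tr(x R(x)) + b)ₓ` of the code `code₀ F L`. -/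
noncomputable def encode₀ : L × F →ₗ[F] Kˣ → F :=
  (encode F L).coprod (LinearMap.pi fun _ => LinearMap.id)

variable {F L}

theorem encode_apply (R : L) (x : Kˣ) : encode F L R x = traceForm F (R : K[X]) x := rfl

theorem encode₀_apply (p : L × F) (x : Kˣ) :
    encode₀ F L p x = traceForm F (p.1 : K[X]) x + p.2 := rfl

theorem range_encode : LinearMap.range (encode F L) = code F L := by
  ext c
  exact ⟨fun ⟨R, hR⟩ => ⟨R, R.2, hR.symm⟩, fun ⟨R, hR, hc⟩ => ⟨⟨R, hR⟩, hc.symm⟩⟩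

theorem range_encode₀ : LinearMap.range (encode₀ F L) = code₀ F L := by
  ext c
  exact ⟨fun ⟨p, hp⟩ => ⟨p.1, p.1.2, p.2, hp.symm⟩,
    fun ⟨R, hR, b, hc⟩ => ⟨(⟨R, hR⟩, b), hc.symm⟩⟩

theorem traceForm_zero_right (R : K[X]) : traceForm F R 0 = 0 := by
  rw [traceForm, zero_mul, map_zero]

theorem encode_injective_of_forall (h : ∀ R ∈ L, (∀ x, traceForm F R x = 0) → R = 0) :
    Function.Injective (encode F L) := by
  refine (injective_iff_map_eq_zero _).2 fun R hR => Subtype.ext (h R R.2 fun x => ?_)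
  rcases eq_or_ne x 0 with rfl | hx
  · exact traceForm_zero_right _
  · exact congrFun hR (Units.mk0 x hx)

theorem encode₀_injective_of_forall (h : Function.Injective (encode F L))
    (hzero : ∀ R ∈ L, ∃ x : Kˣ, traceForm F R x = 0) : Function.Injective (encode₀ F L) := by
  refine (injective_iff_map_eq_zero _).2 fun ⟨R, b⟩ hRb => ?_
  have hconst (x : Kˣ) : traceForm F (R : K[X]) x + b = 0 := congrFun hRb x
  obtain ⟨x, hx⟩ := hzero R R.2
  obtain rfl : b = 0 := by simpa [hx] using hconst x
  obtain rfl : R = 0 := h (_root_.funext fun x => by simpa [encode_apply, traceForm] using hconst x)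
  rfl

section Dimension

theorem finrank_code (h : Function.Injective (encode F L)) :
    finrank F (code F L) = finrank F K * finrank K L := by
  rw [← range_encode, LinearMap.finrank_range_of_inj h, finrank_mul_finrank]

theorem finrank_code₀ [Finite K] (h : Function.Injective (encode₀ F L)) :
    finrank F (code₀ F L) = finrank F K * finrank K L + 1 := by
  have : FiniteDimensional F L :=
    .of_injective (encode₀ F L ∘ₗ LinearMap.inl F L F) (h.comp LinearMap.inl_injective)
  rw [← range_encode₀, LinearMap.finrank_range_of_inj h, finrank_prod, finrank_mul_finrank,
    finrank_self]

theorem finrank_linearizedFamily {q s : ℕ} (hq : 1 < q) {ℓ : Fin s → ℕ}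
    (hinj : Function.Injective ℓ) : finrank K (linearizedFamily K q ℓ) = s := by
  have hindep : LinearIndependent K fun j => (X : K[X]) ^ q ^ ℓ j := by
    simpa only [coe_basisMonomials, Function.comp_def, monomial_one_right_eq_X_pow] using
      (basisMonomials K).linearIndependent.comp _ ((Nat.pow_right_injective hq).comp hinj)
  rw [linearizedFamily, finrank_span_eq_card hindep, Fintype.card_fin]

end Dimension

section Cyclic

theorem traceForm_smul_comp (β : K) (R : K[X]) (x : K) :
    traceForm F (β • R.comp (C β * X)) x = traceForm F R (β * x) := by
  simp only [traceForm, eval_smul, eval_comp, eval_mul, eval_C, eval_X, smul_eq_mul]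
  ring_nf

theorem comp_mem_linearizedFamily {q s : ℕ} {ℓ : Fin s → ℕ} (β : K) {R : K[X]}
    (hR : R ∈ linearizedFamily K q ℓ) : R.comp (C β * X) ∈ linearizedFamily K q ℓ := by
  induction hR using Submodule.span_induction with
  | mem _ h =>
    obtain ⟨j, rfl⟩ := h
    rw [X_pow_comp, mul_pow, ← C_pow, ← smul_eq_C_mul]
    exact Submodule.smul_mem _ _ (Submodule.subset_span (Set.mem_range_self j))
  | zero => simp
  | add _ _ _ _ h₁ h₂ => simpa only [add_comp] using Submodule.add_mem _ h₁ h₂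
  | smul a _ _ h => simpa only [smul_comp] using Submodule.smul_mem _ a h

variable {α : Kˣ} {n : ℕ} (hα : α ^ n = 1) (hL : ∀ β : K, ∀ R ∈ L, R.comp (C β * X) ∈ L)

include hα hL

theorem isCyclicCode_code : IsCyclicCode (orderBy F α n (code F L)) := by
  refine isCyclicCode_orderBy hα ?_
  rintro _ ⟨R, hR, rfl⟩
  refine ⟨_, L.smul_mem (α⁻¹ : Kˣ) (hL (α⁻¹ : Kˣ) R hR), ?_⟩
  ext x
  rw [traceForm_smul_comp, ← Units.val_mul]

theorem isCyclicCode_code₀ : IsCyclicCode (orderBy F α n (code₀ F L)) := by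
  refine isCyclicCode_orderBy hα ?_
  rintro _ ⟨R, hR, b, rfl⟩
  refine ⟨_, L.smul_mem (α⁻¹ : Kˣ) (hL (α⁻¹ : Kˣ) R hR), b, ?_⟩
  ext x
  rw [traceForm_smul_comp, ← Units.val_mul]

end Cyclic

end Codes

section Weights

variable {F K : Type*} [Field F] [DecidableEq F] [Field K] [Fintype K]

/-- The weight of `(Tr(x R(x)))ₓ` in length `q ^ m - 1` when `Q_R` has even rank `r` and type
`(-1) ^ (i + 1)`. -/
def weight (q m r i : ℕ) : ℤ :=
  (q : ℤ) ^ m - (q : ℤ) ^ (m - 1) + (-1) ^ i * ((q : ℤ) - 1) * (q : ℤ) ^ (m - r / 2 - 1)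

/-- The weight of `(Tr(x R(x)) + b)ₓ`, for a constant `b ≠ 0`, in length `q ^ m - 1` when `Q_R` has
even rank `r` and type `(-1) ^ (i + 1)`. -/
def shiftedWeight (q m r i : ℕ) : ℤ :=
  (q : ℤ) ^ m - (q : ℤ) ^ (m - 1) + (-1) ^ (i + 1) * (q : ℤ) ^ (m - r / 2 - 1) - 1

theorem hammingNorm_units_add_card_fiber [DecidableEq K] (f : K → F) :
    hammingNorm (fun x : Kˣ => f x) + (if f 0 = 0 then 0 else 1) + #{x | f x = 0} =
      Fintype.card K := by
  have hunits : hammingNorm (fun x : Kˣ => f x) =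
      ∑ x : {x : K // x ≠ 0}, if f x ≠ 0 then 1 else 0 := by
    rw [hammingNorm, Finset.card_filter]
    exact Equiv.sum_comp (unitsEquivNeZero (G₀ := K)) fun x => if f x ≠ 0 then 1 else 0
  have hsupport : #{x | f x ≠ 0} =
      (if f 0 = 0 then 0 else 1) + hammingNorm (fun x : Kˣ => f x) := by
    rw [hunits, Finset.card_filter, Fintype.sum_eq_add_sum_subtype_ne _ 0]
    simp only [ne_eq, ite_not]
  rw [← Finset.card_univ, ← Finset.card_filter_add_card_filter_not (s := Finset.univ) (f · = 0),
    hsupport, add_comm, add_comm (hammingNorm _)]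

variable [Fintype F] [Algebra F K] {Q : K → F} {r i : ℕ}

theorem HasRank.card_fiber (h : HasRank Q r) (hr : Even r) (hi : HasType Q i) (c : F) :
    (#{x | Q x = c} : ℤ) = (Fintype.card F : ℤ) ^ (finrank F K - 1) +
      (-1) ^ i * (Fintype.card F : ℤ) ^ (finrank F K - r / 2 - 1) -
        if c = 0 then (-1) ^ i * (Fintype.card F : ℤ) ^ (finrank F K - r / 2) else 0 := by
  have hq : (Fintype.card F : ℤ) ≠ 0 := by exact_mod_cast Fintype.card_ne_zero
  have hK : (Fintype.card K : ℤ) = Fintype.card F * (Fintype.card F : ℤ) ^ (finrank F K - 1) := by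
    rw [card_eq_pow_finrank (K := F), Nat.cast_pow, mul_pow_sub_one finrank_pos.ne']
  have hexponent : finrank F K - r / 2 ≠ 0 := by
    have := h.le_finrank
    have := finrank_pos (R := F) (M := K)
    omega
  apply mul_left_cancel₀ hq
  rw [h.hasExcess hr hi c, hK, ← mul_pow_sub_one hexponent]
  split_ifs <;> ring

variable [DecidableEq K]

theorem HasRank.hammingNorm_eq_weight (h : HasRank Q r) (hr : Even r) (hi : HasType Q i) :
    (hammingNorm (fun x : Kˣ => Q x) : ℤ) = weight (Fintype.card F) (finrank F K) r i := by
  have hcount := congrArg (Nat.cast (R := ℤ)) (hammingNorm_units_add_card_fiber Q)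
  have hexponent : finrank F K - r / 2 ≠ 0 := by
    have := h.le_finrank
    have := finrank_pos (R := F) (M := K)
    omega
  rw [if_pos h.map_zero, card_eq_pow_finrank (K := F), Nat.cast_add, h.card_fiber hr hi, if_pos rfl,
    ← mul_pow_sub_one hexponent] at hcount
  push_cast at hcount
  rw [weight]
  linear_combination hcount

theorem HasRank.hammingNorm_add_eq_shiftedWeight (h : HasRank Q r) (hr : Even r)
    (hi : HasType Q i) {b : F} (hb : b ≠ 0) :
    (hammingNorm (fun x : Kˣ => Q x + b) : ℤ) =
      shiftedWeight (Fintype.card F) (finrank F K) r i := by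
  have hcount := congrArg (Nat.cast (R := ℤ)) (hammingNorm_units_add_card_fiber fun x => Q x + b)
  simp only [add_eq_zero_iff_eq_neg] at hcount
  rw [h.map_zero, if_neg (by simpa [eq_comm] using hb), card_eq_pow_finrank (K := F), Nat.cast_add,
    h.card_fiber hr hi, if_neg (neg_ne_zero.2 hb)] at hcount
  push_cast at hcount
  rw [shiftedWeight]
  linear_combination hcount

end Weights

section Distribution

variable {F K : Type*} [Field F] [Field K]

theorem frequency_range [DecidableEq F] {M ι : Type*} [AddCommGroup M] [Module F M] [Fintype M]
    [Fintype ι] {Φ : M →ₗ[F] ι → F} (hΦ : Function.Injective Φ) (w : ℕ) :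
    frequency (LinearMap.range Φ) w = #{a | hammingNorm (Φ a) = w} := by
  have himage : {c : ι → F | c ∈ LinearMap.range Φ ∧ hammingNorm c = w} =
      Φ '' ({a | hammingNorm (Φ a) = w} : Finset M) := by
    ext c
    constructor
    · rintro ⟨⟨a, rfl⟩, h⟩
      exact ⟨a, by simpa using h, rfl⟩
    · rintro ⟨a, h, rfl⟩
      exact ⟨⟨a, rfl⟩, by simpa using h⟩
  rw [frequency, himage, Set.ncard_image_of_injective _ hΦ, Set.ncard_coe_finset]

variable [Algebra F K] {L : Submodule K K[X]}

theorem rankTypeCount_eq_card [Fintype L] (r i : ℕ)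
    [DecidablePred fun R : L => (R : K[X]) ∈ rankTypeSet F L r i] :
    rankTypeCount F L r i = #{R : L | (R : K[X]) ∈ rankTypeSet F L r i} := by
  have himage : rankTypeSet F L r i =
      Subtype.val '' (({R | (R : K[X]) ∈ rankTypeSet F L r i} : Finset L) : Set L) := by
    ext R
    simpa using fun h : R ∈ rankTypeSet F L r i => h.1
  exact (congrArg Set.ncard himage).trans <|
    (Set.ncard_image_of_injective _ Subtype.val_injective).trans (Set.ncard_coe_finset _)

theorem exists_mem_rankTypeSet_iff [Finite F] [Finite K] (heven : IsEvenRankFamily F L) {R : K[X]}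
    (hR : R ∈ L) (hR0 : R ≠ 0) :
    ∃ r ∈ rankSet F L, ∃ i ∈ ({1, 2} : Finset ℕ),
      ∀ r' i', R ∈ rankTypeSet F L r' i' ↔ r' = r ∧ i' = i := by
  classical
  have := Fintype.ofFinite F
  have := Fintype.ofFinite K
  obtain ⟨r, hr, hrank⟩ := heven R hR
  obtain ⟨i, hi, -⟩ := hrank.exists_hasType hr
  refine ⟨r, ?_, i, hi.mem, fun r' i' => ⟨?_, ?_⟩⟩
  · exact Finset.mem_filter.2
      ⟨Finset.mem_range.2 (Nat.lt_succ_of_le hrank.le_finrank), R, hR, hrank⟩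
  · rintro ⟨-, -, hrank', hi'⟩
    exact ⟨hrank'.unique hrank, HasType.unique hi' hi⟩
  · rintro ⟨rfl, rfl⟩
    exact ⟨hR, hR0, hrank, hi⟩

theorem sum_eq_add_sum_rankTypeCount [Finite F] [Finite K] [Fintype L]
    (heven : IsEvenRankFamily F L) (f : L → ℕ) (g : ℕ → ℕ → ℕ)
    (hfg : ∀ r i, ∀ R : L, (R : K[X]) ∈ rankTypeSet F L r i → f R = g r i) :
    ∑ R, f R = f 0 + ∑ r ∈ rankSet F L, ∑ i ∈ ({1, 2} : Finset ℕ),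
      rankTypeCount F L r i * g r i := by
  classical
  have hclass (R : L) : (if R = 0 then 0 else f R) =
      ∑ r ∈ rankSet F L, ∑ i ∈ ({1, 2} : Finset ℕ),
        if (R : K[X]) ∈ rankTypeSet F L r i then g r i else 0 := by
    split_ifs with hR
    · simp [hR, rankTypeSet]
    · obtain ⟨r, hr, i, hi, hmem⟩ := exists_mem_rankTypeSet_iff heven R.2 (by simpa using hR)
      rw [hfg r i R ((hmem r i).2 ⟨rfl, rfl⟩)]
      simp only [hmem, ite_and]
      rw [Finset.sum_eq_single_of_mem r hr (by simp +contextual), Finset.sum_eq_single_of_mem i hi]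
      all_goals simp +contextual
  have hsplit : ∑ R, f R = f 0 + ∑ R : L, if R = 0 then 0 else f R := by
    rw [Fintype.sum_eq_add_sum_compl 0, Fintype.sum_eq_add_sum_compl (0 : L) fun R => ite _ _ _]
    rw [if_pos rfl, zero_add]
    congr 1
    exact Finset.sum_congr rfl fun R hR => (if_neg (by simpa using hR)).symm
  rw [hsplit]
  congr 1
  simp only [hclass, rankTypeCount_eq_card, Finset.card_filter, Finset.sum_mul, ite_mul, one_mul,
    zero_mul]
  rw [Finset.sum_comm]
  exact Finset.sum_congr rfl fun r _ => Finset.sum_comm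

theorem IsEvenRankFamily.even_of_mem_rankTypeSet (heven : IsEvenRankFamily F L) {R : K[X]}
    {r i : ℕ} (hR : R ∈ rankTypeSet F L r i) : Even r := by
  obtain ⟨r', hr', hrank⟩ := heven R hR.1
  rwa [hR.2.2.1.unique hrank]

variable [Fintype F] [Fintype K] [DecidableEq F] [DecidableEq K]

theorem frequency_code (heven : IsEvenRankFamily F L) (hinj : Function.Injective (encode F L))
    (w : ℕ) :
    frequency (code F L) w = (if w = 0 then 1 else 0) +
      ∑ r ∈ rankSet F L, ∑ i ∈ ({1, 2} : Finset ℕ),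
        if (w : ℤ) = weight (Fintype.card F) (finrank F K) r i then rankTypeCount F L r i
        else 0 := by
  have := Fintype.ofInjective _ hinj
  rw [← range_encode, frequency_range hinj, Finset.card_filter, sum_eq_add_sum_rankTypeCount heven _
    fun r i => if (w : ℤ) = weight (Fintype.card F) (finrank F K) r i then 1 else 0]
  · simp only [map_zero, hammingNorm_zero, eq_comm (a := w), mul_ite, mul_one, mul_zero]
  · intro r i R hR
    have hw := hR.2.2.1.hammingNorm_eq_weight (heven.even_of_mem_rankTypeSet hR) hR.2.2.2
    simp only [← hw, Nat.cast_inj, eq_comm (a := w)]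
    rfl

theorem card_filter_eq_of_forall_ne_zero {A B : Type*} [Fintype A] [Zero A] [DecidableEq B]
    {n : A → B} {v : B} (hn : ∀ a ≠ 0, n a = v) (w : B) :
    #{a | n a = w} = (if w = n 0 then 1 else 0) + if w = v then Fintype.card A - 1 else 0 := by
  classical
  rw [Finset.card_filter, Fintype.sum_eq_add_sum_compl 0,
    Finset.sum_congr rfl fun a ha => by rw [hn a (by simpa using ha)]]
  simp only [Finset.sum_const, Finset.card_compl, Finset.card_singleton, smul_eq_mul, mul_ite,
    mul_one, mul_zero, eq_comm (a := w)]

theorem frequency_code₀ (heven : IsEvenRankFamily F L) (hinj : Function.Injective (encode₀ F L))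
    (w : ℕ) :
    frequency (code₀ F L) w = (if w = 0 then 1 else 0) +
      (if w = Fintype.card F ^ finrank F K - 1 then Fintype.card F - 1 else 0) +
      ∑ r ∈ rankSet F L, ∑ i ∈ ({1, 2} : Finset ℕ),
        ((if (w : ℤ) = weight (Fintype.card F) (finrank F K) r i then rankTypeCount F L r i
          else 0) +
        if (w : ℤ) = shiftedWeight (Fintype.card F) (finrank F K) r i
          then rankTypeCount F L r i * (Fintype.card F - 1) else 0) := by
  have := Fintype.ofInjective (fun R : L => encode₀ F L (R, 0))
    (hinj.comp (Prod.mk_left_injective 0))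
  rw [← range_encode₀, frequency_range hinj, card_filter_prod, sum_eq_add_sum_rankTypeCount heven _
    fun r i => (if (w : ℤ) = weight (Fintype.card F) (finrank F K) r i then 1 else 0) +
      if (w : ℤ) = shiftedWeight (Fintype.card F) (finrank F K) r i then Fintype.card F - 1 else 0]
  · have hconst (b : F) (hb : b ≠ 0) :
        hammingNorm (encode₀ F L (0, b)) = Fintype.card F ^ finrank F K - 1 := by
      simp [hammingNorm, encode₀_apply, traceForm, hb, Fintype.card_units,
        card_eq_pow_finrank (K := F) (V := K)]
    rw [card_filter_eq_of_forall_ne_zero hconst, Prod.mk_zero_zero, map_zero, hammingNorm_zero]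
    simp only [mul_add, mul_ite, mul_one, mul_zero]
  · intro r i R hR
    have hr := heven.even_of_mem_rankTypeSet hR
    have hw : (hammingNorm (encode₀ F L (R, 0)) : ℤ) =
        weight (Fintype.card F) (finrank F K) r i := by
      rw [← hR.2.2.1.hammingNorm_eq_weight hr hR.2.2.2]
      simp only [hammingNorm, encode₀_apply, add_zero]
    have hw' (b : F) (hb : b ≠ 0) : (hammingNorm (encode₀ F L (R, b)) : ℤ) =
        shiftedWeight (Fintype.card F) (finrank F K) r i :=
      hR.2.2.1.hammingNorm_add_eq_shiftedWeight hr hR.2.2.2 hb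
    simpa only [Nat.cast_inj, hw] using
      card_filter_eq_of_forall_ne_zero (n := fun b => (hammingNorm (encode₀ F L (R, b)) : ℤ))
        hw' w

end Distribution

end TraceCode

theorem theorem3p3 {F K : Type*} [Field F] [Field K] [Algebra F K]
    [Fintype F] [Fintype K] [DecidableEq F] [DecidableEq K]
    (q m s : ℕ) (hq : Fintype.card F = q) (hm : Module.finrank F K = m)
    (ℓ : Fin s → ℕ) (hmono : StrictMono ℓ)
    (hpos : ∀ j, 1 ≤ ℓ j) (hlt : ∀ j, 2 * ℓ j < m)
    (L : Submodule K (Polynomial K)) (hL : L = TraceCode.linearizedFamily K q ℓ)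
    (heven : TraceCode.IsEvenRankFamily F L) :
    -- both codes are cyclic codes of length `q ^ m - 1`
    (∀ α : Kˣ, (∀ x : Kˣ, x ∈ Subgroup.zpowers α) →
      TraceCode.IsCyclicCode (TraceCode.orderBy F α (q ^ m - 1) (TraceCode.code F L)) ∧
      TraceCode.IsCyclicCode (TraceCode.orderBy F α (q ^ m - 1) (TraceCode.code₀ F L))) ∧
    -- dimensions
    Module.finrank F (TraceCode.code F L) = m * s ∧
    Module.finrank F (TraceCode.code₀ F L) = m * s + 1 ∧
    -- weight distribution of `C_L`; rows of equal weight are added up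
    (∀ w : ℕ, TraceCode.frequency (TraceCode.code F L) w =
      (if w = 0 then 1 else 0) +
      ∑ r ∈ TraceCode.rankSet F L, ∑ i ∈ ({1, 2} : Finset ℕ),
        (if (w : ℤ) = (q : ℤ) ^ m - (q : ℤ) ^ (m - 1)
              + (-1) ^ i * ((q : ℤ) - 1) * (q : ℤ) ^ (m - r / 2 - 1)
          then TraceCode.rankTypeCount F L r i else 0)) ∧
    -- weight distribution of `C_{L,0}`; rows of equal weight are added up
    (∀ w : ℕ, TraceCode.frequency (TraceCode.code₀ F L) w =
      (if w = 0 then 1 else 0) +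
      (if w = q ^ m - 1 then q - 1 else 0) +
      ∑ r ∈ TraceCode.rankSet F L, ∑ i ∈ ({1, 2} : Finset ℕ),
        ((if (w : ℤ) = (q : ℤ) ^ m - (q : ℤ) ^ (m - 1)
              + (-1) ^ i * ((q : ℤ) - 1) * (q : ℤ) ^ (m - r / 2 - 1)
          then TraceCode.rankTypeCount F L r i else 0) +
         (if (w : ℤ) = (q : ℤ) ^ m - (q : ℤ) ^ (m - 1)
              + (-1) ^ (i + 1) * (q : ℤ) ^ (m - r / 2 - 1) - 1
          then TraceCode.rankTypeCount F L r i * (q - 1) else 0))) := by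
  subst hq hm hL
  have hencode := TraceCode.encode_injective_of_forall fun R hR =>
    TraceCode.eq_zero_of_forall_traceForm_eq_zero (F := F) hmono.injective hpos hlt hR
  have hencode₀ := TraceCode.encode₀_injective_of_forall hencode fun R hR =>
    TraceCode.exists_unit_traceForm_eq_zero hpos hlt hR
  have hdim := TraceCode.finrank_linearizedFamily (K := K)
    (Fintype.one_lt_card (α := F)) hmono.injective
  have hshift (β : K) : ∀ R ∈ TraceCode.linearizedFamily K (Fintype.card F) ℓ,
      R.comp (C β * X) ∈ TraceCode.linearizedFamily K (Fintype.card F) ℓ :=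
    fun R hR => TraceCode.comp_mem_linearizedFamily β hR
  have horder (α : Kˣ) : α ^ (Fintype.card F ^ finrank F K - 1) = 1 := by
    rw [← card_eq_pow_finrank, ← Fintype.card_units, pow_card_eq_one]
  refine ⟨fun α _ => ⟨TraceCode.isCyclicCode_code (horder α) hshift,
    TraceCode.isCyclicCode_code₀ (horder α) hshift⟩, ?_, ?_,
    TraceCode.frequency_code heven hencode, TraceCode.frequency_code₀ heven hencode₀⟩
  · rw [TraceCode.finrank_code hencode, hdim]
  · rw [TraceCode.finrank_code₀ hencode₀, hdim]
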